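/- A \emph{network} is a finite directed acyclic multigraph together with finitely many messages; each message is generated at one node and is demanded by one or more nodes. A $(k,n)$ \emph{coding solution} over a finite alphabet $\mathcal A$ with $|\mathcal A|\ge 2$ (where $k,n\ge 1$) assigns to every edge a function computing a vector in $\mathcal A^n$, and to every demand at a node a function computing a vector in $\mathcal A^k$, from the inputs of the relevant node (for an edge, its tail), namely the vectors in $\mathcal A^n$ carried by the in-edges of the node and the messages in $\mathcal A^k$ generated at it, in such a way that for all values of the messages every demanded message is computed correctly. The solution is \emph{linear} if $\mathcal A$ is a finite field and all these functions are linear. The \emph{coding capacity} (over $\mathcal A$) is $\sup\{k/n : \text{a } (k,n) \text{ coding solution over } \mathcal A \text{ exists}\}$, and the \emph{linear coding capacity} over a finite field $F$ is the same supremum restricted to linear solutions over $F$. The \emph{T8 network} has messages $A,B,C,D$, generated at four separate source nodes $s_A,s_B,s_C,s_D$, further nodes $n_1,\dots,n_{15}$, and the following edges: \begin{itemize} \item from $s_A,s_B,s_C$ to $n_1$; from $s_B,s_C,s_D$ to $n_3$; from $s_A,s_C,s_D$ to $n_5$; \item $(n_1,n_2)$, $(n_3,n_4)$, $(n_5,n_6)$;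 from $n_2,n_4,n_6$ to $n_7$; $(n_7,n_8)$; \item from $s_B,s_D,n_8$ to $n_9$; from $s_A,n_4,n_2$ to $n_{10}$; from $s_D,n_8,n_2$ to $n_{11}$; from $s_D,n_6,n_2$ to $n_{12}$; from $s_B,n_6,n_8$ to $n_{13}$; from $s_A,n_4,n_8$ to $n_{14}$; from $s_A,n_4,n_6$ to $n_{15}$. \end{itemize} The nodes $n_9,n_{10},n_{11},n_{12},n_{13},n_{14},n_{15}$ demand $A,D,C,B,C,C,B$ respectively, and there are no other demands. \textbf{Corollary.} For the T8 network: \begin{enumerate} \item the linear coding capacity over every finite field of characteristic different from $3$ is at most $48/49$; \item the linear coding capacity over every finite field of characteristic $3$ equals $1$; \item the coding capacity equals $1$, both over every fixed finite alphabet with at least two symbols and when the supremum is taken over all such alphabets. \end{enumerate} -/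

import Mathlib

open scoped ENNReal

/-- A network: a finite, directed, acyclic multigraph with messages and demands.
Every message originates at one node and is demanded by at least one node. -/
structure Network where
  Node : Type
  Edge : Type
  Msg : Type
  finite_node : Finite Node
  finite_edge : Finite Edge
  finite_msg : Finite Msg
  tail : Edge → Node
  head : Edge → Node
  source : Msg → Node
  demand : Node → Set Msg
  acyclic : ∀ v, ¬ Relation.TransGen (fun u w => ∃ e, tail e = u ∧ head e = w) v v
  demanded : ∀ m, ∃ v, m ∈ demand v

namespace Network

/-- The in-edges of a node. -/
abbrev InEdge (N : Network) (v : N.Node) : Type := {e : N.Edge // N.head e = v}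

/-- The messages generated at a node. -/
abbrev MsgAt (N : Network) (v : N.Node) : Type := {m : N.Msg // N.source m = v}

/-- The inputs of the node `v`: a vector of `n` symbols for every in-edge, and a vector of `k`
symbols for every message generated at `v`. -/
abbrev Inputs (N : Network) (𝒜 : Type*) (k n : ℕ) (v : N.Node) : Type _ :=
  (N.InEdge v → Fin n → 𝒜) × (N.MsgAt v → Fin k → 𝒜)

/-- A `(k, n)` code over the alphabet `𝒜`: every output of a node (the vector on an out-edge, or a
demanded message) is assigned a function of the inputs of that node. -/
structure Code (N : Network) (𝒜 : Type*) (k n : ℕ) where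
  edgeFn : ∀ e : N.Edge, N.Inputs 𝒜 k n (N.tail e) → Fin n → 𝒜
  decodeFn : ∀ (v : N.Node) (m : N.Msg), m ∈ N.demand v → N.Inputs 𝒜 k n v → Fin k → 𝒜

/-- The inputs seen at the node `v` when the messages are `x` and the edges carry `w`. -/
def inputsAt (N : Network) {𝒜 : Type*} {k n : ℕ} (x : N.Msg → Fin k → 𝒜)
    (w : N.Edge → Fin n → 𝒜) (v : N.Node) : N.Inputs 𝒜 k n v :=
  (fun e => w e.1, fun m => x m.1)

namespace Code

variable {N : Network} {𝒜 : Type*} {k n : ℕ}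

/-- `w` is what the edges carry under the code `c` when the messages are `x`. -/
def Carries (c : N.Code 𝒜 k n) (x : N.Msg → Fin k → 𝒜) (w : N.Edge → Fin n → 𝒜) : Prop :=
  ∀ e, w e = c.edgeFn e (N.inputsAt x w (N.tail e))

/-- `c` is a coding solution: for all values of the messages, every demand is met.
(As the network is acyclic, the edge vectors `w` carried for the messages `x` exist and are
unique.) -/
def IsSolution (c : N.Code 𝒜 k n) : Prop :=
  ∀ x : N.Msg → Fin k → 𝒜, ∃ w : N.Edge → Fin n → 𝒜, c.Carries x w ∧
    ∀ (v : N.Node) (m : N.Msg) (h : m ∈ N.demand v), c.decodeFn v m h (N.inputsAt x w v) = x m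

/-- All functions of the code are linear over the field `F`, jointly in the inputs. -/
def IsLinear {F : Type*} [Field F] (c : N.Code F k n) : Prop :=
  (∀ e, IsLinearMap F (c.edgeFn e)) ∧ ∀ v m h, IsLinearMap F (c.decodeFn v m h)

end Code

/-- The coding capacity over the alphabet `𝒜`: the supremum of `k / n` over all `(k, n)` coding
solutions over `𝒜`. The supremum is taken in `[0, ∞]`. -/
noncomputable def codingCapacityOver (N : Network) (𝒜 : Type*) : ℝ≥0∞ :=
  sSup {r | ∃ k n : ℕ, 0 < k ∧ 0 < n ∧ (∃ c : N.Code 𝒜 k n, c.IsSolution) ∧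
    r = (k : ℝ≥0∞) / (n : ℝ≥0∞)}

/-- The coding capacity, with the alphabet left free: the supremum of `k / n` over all `(k, n)`
coding solutions over all finite alphabets with at least two symbols. -/
noncomputable def codingCapacity (N : Network) : ℝ≥0∞ :=
  sSup {r | ∃ 𝒜 : Type, Finite 𝒜 ∧ Nontrivial 𝒜 ∧ ∃ k n : ℕ, 0 < k ∧ 0 < n ∧
    (∃ c : N.Code 𝒜 k n, c.IsSolution) ∧ r = (k : ℝ≥0∞) / (n : ℝ≥0∞)}

/-- The linear coding capacity over the field `F`: the supremum of `k / n` over all `(k, n)` linear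
solutions over `F`. -/
noncomputable def linearCapacityOver (N : Network) (F : Type*) [Field F] : ℝ≥0∞ :=
  sSup {r | ∃ k n : ℕ, 0 < k ∧ 0 < n ∧ (∃ c : N.Code F k n, c.IsLinear ∧ c.IsSolution) ∧
    r = (k : ℝ≥0∞) / (n : ℝ≥0∞)}

end Network

namespace T8

/-- The four messages. -/
inductive Msg
  | A | B | C | D
  deriving DecidableEq

open Msg in
instance : Fintype Msg where
  elems := {A, B, C, D}
  complete m := by cases m <;> decide

/-- The nodes: one source node `sA`, `sB`, `sC`, `sD` for each message, and `n1`, ..., `n15`. -/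
inductive Node
  | sA | sB | sC | sD
  | n1 | n2 | n3 | n4 | n5 | n6 | n7 | n8
  | n9 | n10 | n11 | n12 | n13 | n14 | n15
  deriving DecidableEq

open Node in
instance : Fintype Node where
  elems := {sA, sB, sC, sD, n1, n2, n3, n4, n5, n6, n7, n8, n9, n10, n11, n12, n13, n14, n15}
  complete v := by cases v <;> decide

open Node in
/-- The edges, as pairs (tail, head). The edges `(n1, n2)`, `(n3, n4)`, `(n5, n6)`, `(n7, n8)` are
those labelled `Z`, `W`, `X`, `Y`. -/
def edges : List (Node × Node) :=
  [ (sA, n1), (sB, n1), (sC, n1), (n1, n2),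
    (sB, n3), (sC, n3), (sD, n3), (n3, n4),
    (sA, n5), (sC, n5), (sD, n5), (n5, n6),
    (n4, n7), (n6, n7), (n2, n7), (n7, n8),
    (sB, n9), (sD, n9), (n8, n9),
    (sA, n10), (n4, n10), (n2, n10),
    (sD, n11), (n8, n11), (n2, n11),
    (sD, n12), (n6, n12), (n2, n12),
    (sB, n13), (n6, n13), (n8, n13),
    (sA, n14), (n4, n14), (n8, n14),
    (sA, n15), (n4, n15), (n6, n15) ]

/-- The node that generates a message. -/
def source : Msg → Node
  | .A => .sA
  | .B => .sB
  | .C => .sC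
  | .D => .sD

/-- The messages demanded by a node. -/
def demand : Node → Set Msg
  | .n9 => {.A}
  | .n10 => {.D}
  | .n11 => {.C}
  | .n12 => {.B}
  | .n13 => {.C}
  | .n14 => {.C}
  | .n15 => {.B}
  | _ => ∅

/-- Position in a topological order; used only to show that the network is acyclic. -/
def level : Node → ℕ
  | .sA | .sB | .sC | .sD => 0
  | .n1 | .n3 | .n5 => 1
  | .n2 | .n4 | .n6 => 2
  | .n7 => 3
  | .n8 => 4
  | _ => 5

theorem level_lt : ∀ p ∈ edges, level p.1 < level p.2 := by simp [edges, level]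

theorem level_lt_of_transGen {u v : Node}
    (h : Relation.TransGen
      (fun u w => ∃ e : {p : Node × Node // p ∈ edges}, e.1.1 = u ∧ e.1.2 = w) u v) :
    level u < level v := by
  induction h with
  | single h => obtain ⟨e, rfl, rfl⟩ := h; exact level_lt _ e.2
  | tail _ h ih => obtain ⟨e, rfl, rfl⟩ := h; exact ih.trans (level_lt _ e.2)

/-- The T8 network. -/
abbrev network : Network where
  Node := Node
  Edge := {p : Node × Node // p ∈ edges}
  Msg := Msg
  finite_node := inferInstance
  finite_edge := inferInstance
  finite_msg := inferInstance
  tail e := e.1.1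
  head e := e.1.2
  source := source
  demand := demand
  acyclic _ h := lt_irrefl _ (level_lt_of_transGen h)
  demanded m := by
    cases m
    · exact ⟨.n9, rfl⟩
    · exact ⟨.n12, rfl⟩
    · exact ⟨.n11, rfl⟩
    · exact ⟨.n10, rfl⟩

end T8

/-! ### Linear algebra -/

/-! Let W, X, Y, Z be the vectors on `(n3, n4)`, `(n5, n6)`, `(n7, n8)`, `(n1, n2)`. The natural
code sends sums: Z = A+B+C, W = B+C+D, X = A+C+D, Y = W+X+Z. If 3 = 0 then Y = -(A+B+D) and every
demand is met. This needs only an abelian group of exponent 3, so powers of `ZMod 3` serve any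
alphabet: (ZMod 3)^m fits between k and k+2 symbols, giving rates k/(k+2) → 1 (`sumCode_isSolution`,
`exists_isSolution`). Conversely, with B and D fixed, `n9` recovers A from Y alone, so k ≤ n
(`le_of_isSolution`).

If 3 is invertible, a linear solution must lose rate (`twelve_mul_finrank_le`). For c outside a loss
of dimension proportional to n-k, there are a, b, d whose contributions to W, X, Z agree with those
of c. The messages (a, b, -2c, d) then annihilate W, X, Z, hence Y. If the Y-contributions of a, b,
d also agree and that of c is zero, this reads 3·Ya a = 0, which forces a = 0 and then c = 0. The
conditions on c cost at most 11(n-k) dimensions, so k ≤ 11(n-k), and the rate is at most 11/12 <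
48/49. -/

section LinearAlgebra

variable {F U V : Type*} [Field F] [AddCommGroup U] [Module F U] [AddCommGroup V] [Module F V]
  [FiniteDimensional F U] [FiniteDimensional F V]

open Module

theorem finrank_le_finrank_inf_add (S T : Submodule F U) :
    finrank F S + finrank F T ≤ finrank F (S ⊓ T : Submodule F U) + finrank F U := by
  have h := Submodule.finrank_sup_add_finrank_inf_eq S T
  have h' := Submodule.finrank_le (S ⊔ T)
  omega

/-- Taking preimages does not increase codimension: the quotient by the preimage embeds in the
quotient by `S`. -/
theorem finrank_le_finrank_comap (L : U →ₗ[F] U) (S : Submodule F U) :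
    finrank F S ≤ finrank F (S.comap L) := by
  have h := LinearMap.finrank_range_add_finrank_ker (S.mkQ ∘ₗ L)
  have h' := Submodule.finrank_le (LinearMap.range (S.mkQ ∘ₗ L))
  have h'' := Submodule.finrank_quotient_add_finrank S
  rw [LinearMap.ker_comp, Submodule.ker_mkQ] at h
  omega

/-- If the homogeneous system `f₁ u + f₂ v + f₃ w = 0`, `g₁ u + g₂ v + g₃ w = 0` forces `w = 0`, then
`f₁ u = f₂ v`, `g₁ u = g₂ v` is solvable, linearly in `v`, for all `v` in a large subspace. -/
theorem exists_solve_on_large_submodule (f₁ f₂ f₃ g₁ g₂ g₃ : U →ₗ[F] V)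
    (h : ∀ u v w, f₁ u + f₂ v + f₃ w = 0 → g₁ u + g₂ v + g₃ w = 0 → w = 0)
    (hinj : ∀ u, f₁ u = 0 → g₁ u = 0 → u = 0) :
    ∃ (S : Submodule F U) (L : U →ₗ[F] U),
      3 * finrank F U ≤ finrank F S + 2 * finrank F V ∧
      ∀ v ∈ S, f₁ (L v) = f₂ v ∧ g₁ (L v) = g₂ v := by
  -- The kernel of `Φ` has dimension at least 3 dim U - 2 dim V. On it w = 0 and v determines u, so
  -- it projects injectively to v; the image is `S`, and `L` is v ↦ -u.
  let Φ : (U × U × U) →ₗ[F] V × V :=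
    (f₁.coprod (f₂.coprod f₃)).prod (g₁.coprod (g₂.coprod g₃))
  have hΦ : ∀ κ : LinearMap.ker Φ, f₁ κ.1.1 + f₂ κ.1.2.1 + f₃ κ.1.2.2 = 0 ∧
      g₁ κ.1.1 + g₂ κ.1.2.1 + g₃ κ.1.2.2 = 0 := by
    rintro ⟨κ, hκ⟩
    simpa [Φ, add_assoc] using hκ
  have hw : ∀ κ : LinearMap.ker Φ, κ.1.2.2 = 0 := fun κ => h _ _ _ (hΦ κ).1 (hΦ κ).2
  let π : LinearMap.ker Φ →ₗ[F] U :=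
    LinearMap.fst F U U ∘ₗ LinearMap.snd F U (U × U) ∘ₗ (LinearMap.ker Φ).subtype
  have hπ : LinearMap.ker π = ⊥ := by
    rw [LinearMap.ker_eq_bot']
    intro κ hκ
    have hv : κ.1.2.1 = 0 := hκ
    obtain ⟨h₁, h₂⟩ := hΦ κ
    rw [hw κ, hv] at h₁ h₂
    have hu : κ.1.1 = 0 := hinj _ (by simpa using h₁) (by simpa using h₂)
    exact Subtype.ext (Prod.ext hu (Prod.ext hv (hw κ)))
  obtain ⟨R, hR⟩ := π.exists_leftInverse_of_injective hπ
  refine ⟨LinearMap.range π, -(LinearMap.fst F U (U × U) ∘ₗ (LinearMap.ker Φ).subtype ∘ₗ R), ?_, ?_⟩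
  · have h₁ := LinearMap.finrank_range_add_finrank_ker Φ
    have h₂ := Submodule.finrank_le (LinearMap.range Φ)
    have h₃ := LinearMap.finrank_range_of_inj (LinearMap.ker_eq_bot.1 hπ)
    simp only [finrank_prod] at h₁ h₂
    omega
  · rintro _ ⟨κ, rfl⟩
    have hκ : R (π κ) = κ := LinearMap.congr_fun hR κ
    obtain ⟨h₁, h₂⟩ := hΦ κ
    rw [hw κ, map_zero, add_zero] at h₁ h₂
    simp only [LinearMap.neg_apply, LinearMap.comp_apply, hκ, map_neg]
    exact ⟨neg_eq_of_add_eq_zero_right h₁, neg_eq_of_add_eq_zero_right h₂⟩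

/-- The rank inequality behind the linear capacity bound for the T8 network: `Z`, `W`, `X`, `Y` are
linear in the messages `a`, `b`, `c`, `d`, and every hypothesis records what a node computes. -/
theorem twelve_mul_finrank_le (h3 : (3 : F) ≠ 0)
    (Za Zb Zc Wb Wc Wd Xa Xc Xd Ya Yb Yc Yd : U →ₗ[F] V)
    (hY : ∀ a b c d, Wb b + Wc c + Wd d = 0 → Xa a + Xc c + Xd d = 0 → Za a + Zb b + Zc c = 0 →
      Ya a + Yb b + Yc c + Yd d = 0)
    (h9 : ∀ a c, Ya a + Yc c = 0 → a = 0)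
    (h10 : ∀ b c d, Wb b + Wc c + Wd d = 0 → Zb b + Zc c = 0 → d = 0)
    (h11 : ∀ a b c, Ya a + Yb b + Yc c = 0 → Za a + Zb b + Zc c = 0 → c = 0)
    (h12 : ∀ a b c, Xa a + Xc c = 0 → Za a + Zb b + Zc c = 0 → b = 0)
    (h14 : ∀ b c d, Wb b + Wc c + Wd d = 0 → Yb b + Yc c + Yd d = 0 → c = 0)
    (h15 : ∀ b c d, Wb b + Wc c + Wd d = 0 → Xc c + Xd d = 0 → b = 0) :
    12 * finrank F U ≤ 11 * finrank F V := by
  have injWb : ∀ b, Wb b = 0 → b = 0 := fun b h => h15 b 0 0 (by simpa using h) (by simp)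
  have injWd : ∀ d, Wd d = 0 → d = 0 := fun d h => h10 0 0 d (by simpa using h) (by simp)
  have injZb : ∀ b, Zb b = 0 → b = 0 := fun b h => h12 0 b 0 (by simp) (by simpa using h)
  have injYa : ∀ a, Ya a = 0 → a = 0 := fun a h => h9 a 0 (by simpa using h)
  -- With k = dim U and n = dim V, each of the five subspaces has codimension at most 2(n-k). The
  -- first three make b, a, d functions of c; the last two compare the Y-contributions of a with b
  -- and of b with d.
  obtain ⟨S₁, Lb, d₁, e₁⟩ := exists_solve_on_large_submodule Wb Wc Wd Zb Zc 0
    (fun b c d h h' => h10 b c d h (by simpa using h')) (fun b h _ => injWb b h)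
  obtain ⟨S₂, La, d₂, e₂⟩ := exists_solve_on_large_submodule Xa Xc 0 Za Zc Zb
    (fun a c b h h' => h12 a b c (by simpa using h) (by rw [← h']; abel))
    (fun a h h' => injYa a (by
      simpa using hY a 0 0 0 (by simp) (by simpa using h) (by simpa using h')))
  obtain ⟨S₃, Ld, d₃, e₃⟩ := exists_solve_on_large_submodule Wd Wc Wb Xd Xc 0
    (fun d c b h h' => h15 b c d (by rw [← h]; abel) (by rw [← h']; simp [add_comm]))
    (fun d h _ => injWd d h)
  obtain ⟨S₄, M₄, d₄, e₄⟩ := exists_solve_on_large_submodule Yb Ya Yc Zb Za Zc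
    (fun b a c h h' => h11 a b c (by rw [← h]; abel) (by rw [← h']; abel))
    (fun b _ h => injZb b h)
  obtain ⟨S₅, M₅, d₅, e₅⟩ := exists_solve_on_large_submodule Wd Wb Wc Yd Yb Yc
    (fun d b c h h' => h14 b c d (by rw [← h]; abel) (by rw [← h']; abel))
    (fun d h _ => injWd d h)
  -- By `h9` the ranges of `Ya` and `Yc` are independent, and `Ya` has rank k, so `Yc` has rank at
  -- most n-k.
  have d₆ : 2 * finrank F U ≤ finrank F (LinearMap.ker Yc) + finrank F V := by
    have i₁ := LinearMap.finrank_range_add_finrank_ker Ya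
    have i₂ := LinearMap.finrank_range_add_finrank_ker Yc
    have i₃ : LinearMap.ker Ya = ⊥ := LinearMap.ker_eq_bot'.2 injYa
    have i₄ : LinearMap.range Ya ⊓ LinearMap.range Yc = ⊥ := by
      rw [eq_bot_iff]
      rintro _ ⟨⟨a, rfl⟩, ⟨c, hc⟩⟩
      have : a = 0 := h9 a (-c) (by rw [map_neg, hc, add_neg_cancel])
      simp [this]
    have i₅ := finrank_le_finrank_inf_add (LinearMap.range Ya) (LinearMap.range Yc)
    rw [i₃, finrank_bot] at i₁
    rw [i₄, finrank_bot] at i₅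
    omega
  have hbot : ((((S₁ ⊓ S₂) ⊓ S₃) ⊓ S₄.comap La) ⊓ S₅.comap Lb) ⊓ LinearMap.ker Yc = ⊥ := by
    rw [eq_bot_iff]
    rintro c ⟨⟨⟨⟨⟨c₁, c₂⟩, c₃⟩, c₄⟩, c₅⟩, c₆⟩
    obtain ⟨Wb_eq, Zb_eq⟩ := e₁ c c₁
    obtain ⟨Xa_eq, Za_eq⟩ := e₂ c c₂
    obtain ⟨Wd_eq, Xd_eq⟩ := e₃ c c₃
    obtain ⟨Yb_eq, Zb_eq'⟩ := e₄ (La c) c₄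
    obtain ⟨Wd_eq', Yd_eq⟩ := e₅ (Lb c) c₅
    have Yc_eq : Yc c = 0 := c₆
    -- Injectivity of `Zb` and `Wd` identifies the two candidates for b and the two for d.
    have hb : M₄ (La c) = Lb c := by
      rw [← sub_eq_zero]
      exact injZb _ (by rw [map_sub, Zb_eq', Za_eq, Zb_eq, sub_self])
    have hd : M₅ (Lb c) = Ld c := by
      rw [← sub_eq_zero]
      exact injWd _ (by rw [map_sub, Wd_eq', Wb_eq, Wd_eq, sub_self])
    rw [hb] at Yb_eq
    rw [hd] at Yd_eq
    -- W, X and Z each involve c and two of a, b, d, whose contributions both equal that of c; the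
    -- coefficient -2 cancels them in all three.
    have key := hY (La c) (Lb c) (-(c + c)) (Ld c)
      (by rw [map_neg, map_add, Wb_eq, Wd_eq]; abel)
      (by rw [map_neg, map_add, Xa_eq, Xd_eq]; abel)
      (by rw [map_neg, map_add, Za_eq, Zb_eq]; abel)
    rw [map_neg, map_add, Yc_eq, Yd_eq, Yb_eq] at key
    have h3Y : (3 : F) • Ya (La c) = 0 := by
      rw [← key]
      module
    have ha : La c = 0 := injYa _ ((smul_eq_zero.1 h3Y).resolve_left h3)
    rw [ha, map_zero] at Za_eq
    exact h11 0 0 c (by simpa using Yc_eq) (by simpa using Za_eq.symm)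
  -- Codimensions add up to at most 5·2(n-k) + (n-k) = 11(n-k), while the intersection is zero.
  have k₁ := finrank_le_finrank_inf_add S₁ S₂
  have k₂ := finrank_le_finrank_inf_add (S₁ ⊓ S₂) S₃
  have k₃ := finrank_le_finrank_inf_add ((S₁ ⊓ S₂) ⊓ S₃) (S₄.comap La)
  have k₄ := finrank_le_finrank_inf_add (((S₁ ⊓ S₂) ⊓ S₃) ⊓ S₄.comap La) (S₅.comap Lb)
  have k₅ := finrank_le_finrank_inf_add ((((S₁ ⊓ S₂) ⊓ S₃) ⊓ S₄.comap La) ⊓ S₅.comap Lb)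
    (LinearMap.ker Yc)
  rw [hbot, finrank_bot] at k₅
  have k₆ := finrank_le_finrank_comap La S₄
  have k₇ := finrank_le_finrank_comap Lb S₅
  omega

end LinearAlgebra

/-! ### Codes on the T8 network -/

/-! ### The sum code over a group of exponent 3 -/

namespace T8

open Node

/-- The vector arriving at `v` from `u`, read in `G` by `f`, or `0` if there is no such edge. -/
def fromNode {𝒜 G : Type*} [Zero G] {k n : ℕ} (f : (Fin n → 𝒜) → G) {v : Node}
    (i : network.Inputs 𝒜 k n v) (u : Node) : G :=
  if h : (u, v) ∈ edges then f (i.1 ⟨⟨(u, v), h⟩, rfl⟩) else 0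

/-- The message `m`, read in `G` by `f` if it is generated at `v`, or `0` otherwise. -/
def fromMsg {𝒜 G : Type*} [Zero G] {k n : ℕ} (f : (Fin k → 𝒜) → G) {v : Node}
    (i : network.Inputs 𝒜 k n v) (m : Msg) : G :=
  if h : source m = v then f (i.2 ⟨m, h⟩) else 0

/-- The coefficients with which the node `v` combines its inputs to meet its demand. -/
def decodeCoeff (v u : Node) : ℤ :=
  match v, u with
  | n9, _ => -1
  | n10, n2 => -1
  | n12, n6 => -1
  | n15, n6 => -1
  | _, _ => 1

/-- The code in which every node sends the sum of its inputs on all its out-edges, the sum being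
taken in the group `G`. -/
def sumCode {𝒜 G : Type*} [AddCommGroup G] {k n : ℕ} (enc : (Fin k → 𝒜) → G)
    (dec : G → Fin k → 𝒜) (put : G → Fin n → 𝒜) (get : (Fin n → 𝒜) → G) :
    network.Code 𝒜 k n where
  edgeFn _ i := put (∑ u, fromNode get i u + ∑ m, fromMsg enc i m)
  decodeFn v _ _ i := dec (∑ u, decodeCoeff v u • fromNode get i u)

/-- The group element that the node `v` sends in `sumCode`, as a function of the messages. -/
def sent {G : Type*} [AddCommGroup G] (y : Msg → G) : Node → G
  | sA => y .A
  | sB => y .B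
  | sC => y .C
  | sD => y .D
  | n1 | n2 => y .A + y .B + y .C
  | n3 | n4 => y .B + y .C + y .D
  | n5 | n6 => y .A + y .C + y .D
  | n7 | n8 => (y .A + y .B + y .C) + ((y .B + y .C + y .D) + (y .A + y .C + y .D))
  | _ => 0

theorem sum_node {G : Type*} [AddCommGroup G] (f : Node → G) :
    ∑ u, f u = f sA + (f sB + (f sC + (f sD + (f n1 + (f n2 + (f n3 + (f n4 + (f n5 + (f n6 +
      (f n7 + (f n8 + (f n9 + (f n10 + (f n11 + (f n12 + (f n13 + (f n14 +
        f n15))))))))))))))))) := by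
  change ∑ u ∈ ({sA, sB, sC, sD, n1, n2, n3, n4, n5, n6, n7, n8, n9, n10, n11, n12, n13, n14,
    n15} : Finset Node), f u = _
  repeat rw [Finset.sum_insert (by decide)]
  rw [Finset.sum_singleton]

theorem sum_msg {G : Type*} [AddCommGroup G] (f : Msg → G) :
    ∑ m, f m = f .A + (f .B + (f .C + f .D)) := by
  change ∑ m ∈ ({.A, .B, .C, .D} : Finset Msg), f m = _
  repeat rw [Finset.sum_insert (by decide)]
  rw [Finset.sum_singleton]

theorem sumCode_isSolution {𝒜 G : Type*} [AddCommGroup G] {k n : ℕ} (h3 : ∀ g : G, g + g + g = 0)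
    {enc : (Fin k → 𝒜) → G} {dec : G → Fin k → 𝒜} {put : G → Fin n → 𝒜} {get : (Fin n → 𝒜) → G}
    (hdec : ∀ x, dec (enc x) = x) (hget : ∀ g, get (put g) = g) :
    (sumCode enc dec put get).IsSolution := by
  intro x
  let y : Msg → G := fun m => enc (x m)
  let w : network.Edge → Fin n → 𝒜 := fun e => put (sent y e.1.1)
  have hin : ∀ u v, fromNode get (network.inputsAt x w v) u =
      if (u, v) ∈ edges then sent y u else 0 := by
    intro u v
    by_cases h : (u, v) ∈ edges <;> simp [fromNode, Network.inputsAt, w, h, hget]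
  have hmsg : ∀ m v, fromMsg enc (network.inputsAt x w v) m =
      if source m = v then y m else 0 := by
    intro m v
    by_cases h : source m = v <;> simp [fromMsg, Network.inputsAt, y, h]
  refine ⟨w, ?_, ?_⟩
  · rintro ⟨⟨u, v⟩, he⟩
    simp only [w, sumCode, hin, hmsg]
    congr 1
    clear hin hmsg
    rw [sum_node, sum_msg]
    -- The first alternative disposes of the demand nodes, which have no out-edges.
    cases u <;> first
      | (exfalso; revert he; cases v <;> decide)
      | simp [edges, sent, source, add_assoc]
  · intro v m hm
    simp only [sumCode, hin]
    suffices h : (∑ u, decodeCoeff v u • if (u, v) ∈ edges then sent y u else 0) = y m by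
      rw [h, hdec]
    clear hin hmsg
    have h3' : ∀ m, (3 : ℤ) • y m = 0 := fun m => by
      rw [← h3 (y m)]; abel
    rw [sum_node]
    cases v <;> simp only [network, demand, Set.mem_singleton_iff, Set.mem_empty_iff_false] at hm
    all_goals
      subst hm
      simp only [edges, sent, decodeCoeff, List.mem_cons, List.not_mem_nil, Prod.mk.injEq,
        reduceCtorEq, and_true, and_false, or_false, or_true, and_self,
        if_true, if_false, smul_zero, add_zero, zero_add]
    -- The goals that invoke `h3'` are those of the nodes that see Y: `n9`, `n11`, `n13`, `n14`. The
    -- other three hold in any abelian group.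
    · linear_combination (norm := module) -h3' .A - h3' .B - h3' .C - h3' .D
    · module
    · linear_combination (norm := module) h3' .A + h3' .B + h3' .C + h3' .D
    · module
    · linear_combination (norm := module) h3' .A + h3' .B + h3' .C + h3' .D
    · linear_combination (norm := module) h3' .A + h3' .B + h3' .C + h3' .D
    · module

theorem sumCode_isLinear {F G : Type*} [Field F] [AddCommGroup G] [Module F G] {k n : ℕ}
    {enc : (Fin k → F) → G} {dec : G → Fin k → F} {put : G → Fin n → F} {get : (Fin n → F) → G}
    (henc : IsLinearMap F enc) (hdec : IsLinearMap F dec) (hput : IsLinearMap F put)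
    (hget : IsLinearMap F get) : (sumCode enc dec put get).IsLinear := by
  have fn_add : ∀ (v : Node) (i j : network.Inputs F k n v) (u : Node),
      fromNode get (i + j) u = fromNode get i u + fromNode get j u := by
    intro v i j u
    by_cases h : (u, v) ∈ edges <;> simp [fromNode, h, hget.map_add]
  have fn_smul : ∀ (v : Node) (r : F) (i : network.Inputs F k n v) (u : Node),
      fromNode get (r • i) u = r • fromNode get i u := by
    intro v r i u
    by_cases h : (u, v) ∈ edges <;> simp [fromNode, h, hget.map_smul]
  have fm_add : ∀ (v : Node) (i j : network.Inputs F k n v) (m : Msg),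
      fromMsg enc (i + j) m = fromMsg enc i m + fromMsg enc j m := by
    intro v i j m
    by_cases h : source m = v <;> simp [fromMsg, h, henc.map_add]
  have fm_smul : ∀ (v : Node) (r : F) (i : network.Inputs F k n v) (m : Msg),
      fromMsg enc (r • i) m = r • fromMsg enc i m := by
    intro v r i m
    by_cases h : source m = v <;> simp [fromMsg, h, henc.map_smul]
  refine ⟨fun e => ⟨fun i j => ?_, fun r i => ?_⟩, fun v m h => ⟨fun i j => ?_, fun r i => ?_⟩⟩
  · simp only [sumCode, fn_add, fm_add, Finset.sum_add_distrib]
    rw [← hput.map_add]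
    congr 1
    abel
  · simp only [sumCode, fn_smul, fm_smul, ← Finset.smul_sum, ← smul_add, hput.map_smul]
  · simp only [sumCode, fn_add, smul_add, Finset.sum_add_distrib, hdec.map_add]
  · simp only [sumCode, fn_smul, smul_comm _ r, ← Finset.smul_sum, hdec.map_smul]

end T8

/-! ### Uniqueness of the carried vectors and the cut bound k ≤ n -/

namespace T8

open Node

/-- The edge from `u` to `v`. -/
abbrev edge (u v : Node) (h : (u, v) ∈ edges := by simp [edges]) : network.Edge := ⟨(u, v), h⟩

/-- A property of edges that passes from the in-edges of any node to its out-edges holds for all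
edges. -/
theorem edge_induction {P : network.Edge → Prop}
    (h : ∀ e, (∀ e', network.head e' = network.tail e → P e') → P e) (e : network.Edge) : P e := by
  induction hl : level (network.tail e) using Nat.strong_induction_on generalizing e with
  | _ l ih =>
    refine h e fun e' he' => ih _ ?_ e' rfl
    rw [← hl, ← he']
    exact level_lt _ e'.2

theorem source_injective : Function.Injective source := by
  rintro ⟨⟩ ⟨⟩ h <;> first | rfl | cases h

theorem notMem_edges_source (p : Node) (m : Msg) : (p, source m) ∉ edges := by
  cases m <;> simp [edges, source]

section Carries

variable {𝒜 : Type*} {k n : ℕ} {c : network.Code 𝒜 k n}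

theorem carries_congr {x x' : Msg → Fin k → 𝒜} {w w' : network.Edge → Fin n → 𝒜}
    (hw : c.Carries x w) (hw' : c.Carries x' w') {e : network.Edge}
    (he : ∀ e', network.head e' = network.tail e → w e' = w' e')
    (hm : ∀ m, source m = network.tail e → x m = x' m) : w e = w' e := by
  rw [hw e, hw' e]
  congr 1
  exact Prod.ext (funext fun e' => he e'.1 e'.2) (funext fun m => hm m.1 m.2)

theorem carries_unique {x : Msg → Fin k → 𝒜} {w w' : network.Edge → Fin n → 𝒜}
    (hw : c.Carries x w) (hw' : c.Carries x w') : w = w' :=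
  funext <| edge_induction fun _ he => carries_congr hw hw' he fun _ _ => rfl

/-- The vector carried by an edge whose tail is a source node depends on that message only. -/
theorem carries_congr_source {x x' : Msg → Fin k → 𝒜} {w w' : network.Edge → Fin n → 𝒜}
    (hw : c.Carries x w) (hw' : c.Carries x' w') (m : Msg) (hm : x m = x' m) {v : Node}
    (h : (source m, v) ∈ edges) : w ⟨(source m, v), h⟩ = w' ⟨(source m, v), h⟩ := by
  refine carries_congr hw hw' ?_ ?_
  · rintro ⟨⟨p, q⟩, he⟩ (rfl : q = source m)
    exact absurd he (notMem_edges_source p m)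
  · intro m' h'
    rw [source_injective h', hm]

/-- When only message A varies, the edges from `sB` and `sD` into `n9` are constant, so the edge
from `n8` must separate all values of A. -/
theorem le_of_isSolution [Finite 𝒜] [Nontrivial 𝒜] (hc : c.IsSolution) : k ≤ n := by
  choose w hw hdec using hc
  obtain ⟨o⟩ : Nonempty 𝒜 := inferInstance
  let x : (Fin k → 𝒜) → Msg → Fin k → 𝒜 := fun a => Function.update (fun _ _ => o) Msg.A a
  have hinj : Function.Injective fun a => w (x a) (edge n8 n9) := by
    intro a a' (h : w (x a) (edge n8 n9) = w (x a') (edge n8 n9))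
    have hB := carries_congr_source (hw (x a)) (hw (x a')) .B rfl (v := n9) (by simp [edges, source])
    have hD := carries_congr_source (hw (x a)) (hw (x a')) .D rfl (v := n9) (by simp [edges, source])
    have key : network.inputsAt (x a) (w (x a)) n9 = network.inputsAt (x a') (w (x a')) n9 := by
      refine Prod.ext (funext ?_) (funext ?_)
      · rintro ⟨⟨⟨p, q⟩, he⟩, hq⟩
        obtain rfl : q = n9 := hq
        cases p <;> first
          | exact h
          | exact hB
          | exact hD
          | (exfalso; revert he; decide)
      · rintro ⟨m, hm⟩
        cases m <;> cases hm
    have h₁ := hdec (x a) n9 .A rfl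
    have h₂ := hdec (x a') n9 .A rfl
    rw [key, h₂] at h₁
    simpa [x] using h₁.symm
  have := Nat.card_le_card_of_injective _ hinj
  rw [Nat.card_fun, Nat.card_fun, Nat.card_fin, Nat.card_fin] at this
  exact (Nat.pow_le_pow_iff_right Finite.one_lt_card).1 this

end Carries

/-! ### Linear solutions and their bottleneck maps -/

section Linear

variable {F : Type*} [Field F] {k n : ℕ}

/-- In a linear solution the edge vectors are linear in the messages. The vector on an edge vanishes
if the inputs of its tail do, and a demanded message vanishes if the inputs of the node do. -/
theorem exists_linear_of_isSolution {c : network.Code F k n} (hl : c.IsLinear) (hc : c.IsSolution) :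
    ∃ w : (Msg → Fin k → F) →ₗ[F] (network.Edge → Fin n → F),
      (∀ x m v (h : (source m, v) ∈ edges), x m = 0 → w x ⟨(source m, v), h⟩ = 0) ∧
      (∀ x u v (h : (u, v) ∈ edges), (∀ m, source m ≠ u) →
        (∀ p (hp : (p, u) ∈ edges), w x ⟨(p, u), hp⟩ = 0) → w x ⟨(u, v), h⟩ = 0) ∧
      (∀ x v m, m ∈ demand v → (∀ m, source m ≠ v) →
        (∀ p (hp : (p, v) ∈ edges), w x ⟨(p, v), hp⟩ = 0) → x m = 0) := by
  choose w hw hdec using hc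
  have hzero : ∀ {x v}, (∀ m, source m = v → x m = 0) →
      (∀ p (hp : (p, v) ∈ edges), w x ⟨(p, v), hp⟩ = 0) → network.inputsAt x (w x) v = 0 := by
    intro x v h h'
    refine Prod.ext (funext ?_) (funext fun m => h m.1 m.2)
    rintro ⟨⟨⟨p, q⟩, he⟩, rfl⟩
    exact h' p he
  refine ⟨{ toFun := w, map_add' := fun x y => ?_, map_smul' := fun r x => ?_ }, ?_, ?_, ?_⟩
  -- The chosen `w` is linear because the sum of two carried assignments is carried by the sum of
  -- the messages, and carried assignments are unique; likewise for scalars.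
  · refine carries_unique (hw (x + y)) fun e => ?_
    rw [Pi.add_apply, hw x e, hw y e, ← (hl.1 e).map_add]
    rfl
  · refine carries_unique (hw (r • x)) fun e => ?_
    rw [RingHom.id_apply, Pi.smul_apply, hw x e, ← (hl.1 e).map_smul]
    rfl
  · intro x m v h hm
    change w x _ = 0
    rw [hw x, hzero, (hl.1 _).map_zero]
    · intro m' h'
      rw [source_injective h', hm]
    · exact fun p hp => absurd hp (notMem_edges_source p m)
  · intro x u v h hm hp
    change w x _ = 0
    rw [hw x, hzero (fun m h => absurd h (hm m)) hp, (hl.1 _).map_zero]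
  · intro x v m hv hm hp
    rw [← hdec x v m hv, hzero (fun m h => absurd h (hm m)) hp, (hl.2 v m hv).map_zero]

/-- The message vector with the given components. -/
def msgs (a b c d : Fin k → F) : Msg → Fin k → F
  | .A => a
  | .B => b
  | .C => c
  | .D => d

/-- The vectors `W`, `X`, `Y`, `Z` on the edges `(n3, n4)`, `(n5, n6)`, `(n7, n8)`, `(n1, n2)` in a
linear solution. -/
theorem exists_bottleneck_maps {c : network.Code F k n} (hl : c.IsLinear) (hc : c.IsSolution) :
    ∃ W X Y Z : (Msg → Fin k → F) →ₗ[F] (Fin n → F),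
      (∀ x, x .B = 0 → x .C = 0 → x .D = 0 → W x = 0) ∧
      (∀ x, x .A = 0 → x .C = 0 → x .D = 0 → X x = 0) ∧
      (∀ x, x .A = 0 → x .B = 0 → x .C = 0 → Z x = 0) ∧
      (∀ x, W x = 0 → X x = 0 → Z x = 0 → Y x = 0) ∧
      (∀ x, x .B = 0 → x .D = 0 → Y x = 0 → x .A = 0) ∧
      (∀ x, x .A = 0 → W x = 0 → Z x = 0 → x .D = 0) ∧
      (∀ x, x .D = 0 → Y x = 0 → Z x = 0 → x .C = 0) ∧
      (∀ x, x .D = 0 → X x = 0 → Z x = 0 → x .B = 0) ∧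
      (∀ x, x .A = 0 → W x = 0 → Y x = 0 → x .C = 0) ∧
      (∀ x, x .A = 0 → W x = 0 → X x = 0 → x .B = 0) := by
  obtain ⟨w, hsrc, hnode, hdem⟩ := exists_linear_of_isSolution hl hc
  have hA : ∀ x v (h : (sA, v) ∈ edges), x .A = 0 → w x ⟨(sA, v), h⟩ = 0 := fun x => hsrc x .A
  have hB : ∀ x v (h : (sB, v) ∈ edges), x .B = 0 → w x ⟨(sB, v), h⟩ = 0 := fun x => hsrc x .B
  have hC : ∀ x v (h : (sC, v) ∈ edges), x .C = 0 → w x ⟨(sC, v), h⟩ = 0 := fun x => hsrc x .C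
  have hD : ∀ x v (h : (sD, v) ∈ edges), x .D = 0 → w x ⟨(sD, v), h⟩ = 0 := fun x => hsrc x .D
  let W := LinearMap.proj (edge n3 n4) ∘ₗ w
  let X := LinearMap.proj (edge n5 n6) ∘ₗ w
  let Y := LinearMap.proj (edge n7 n8) ∘ₗ w
  let Z := LinearMap.proj (edge n1 n2) ∘ₗ w
  -- Each of `n4`, `n6`, `n8`, `n2` has a single in-edge, so everything it sends vanishes with that
  -- vector.
  have hWout : ∀ x v (h : (n4, v) ∈ edges), W x = 0 → w x ⟨(n4, v), h⟩ = 0 := by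
    intro x v h hx
    refine hnode x _ _ h (by rintro ⟨⟩ ⟨⟩) fun p hp => ?_
    obtain rfl : p = n3 := by simpa [edges] using hp
    exact hx
  have hXout : ∀ x v (h : (n6, v) ∈ edges), X x = 0 → w x ⟨(n6, v), h⟩ = 0 := by
    intro x v h hx
    refine hnode x _ _ h (by rintro ⟨⟩ ⟨⟩) fun p hp => ?_
    obtain rfl : p = n5 := by simpa [edges] using hp
    exact hx
  have hYout : ∀ x v (h : (n8, v) ∈ edges), Y x = 0 → w x ⟨(n8, v), h⟩ = 0 := by
    intro x v h hx
    refine hnode x _ _ h (by rintro ⟨⟩ ⟨⟩) fun p hp => ?_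
    obtain rfl : p = n7 := by simpa [edges] using hp
    exact hx
  have hZout : ∀ x v (h : (n2, v) ∈ edges), Z x = 0 → w x ⟨(n2, v), h⟩ = 0 := by
    intro x v h hx
    refine hnode x _ _ h (by rintro ⟨⟩ ⟨⟩) fun p hp => ?_
    obtain rfl : p = n1 := by simpa [edges] using hp
    exact hx
  refine ⟨W, X, Y, Z, ?_, ?_, ?_, ?_, ?_, ?_, ?_, ?_, ?_, ?_⟩
  · intro x hB₀ hC₀ hD₀
    refine hnode x _ _ _ (by rintro ⟨⟩ ⟨⟩) fun p hp => ?_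
    obtain rfl | rfl | rfl : p = sB ∨ p = sC ∨ p = sD := by
      simpa [edges] using hp
    exacts [hB x _ _ hB₀, hC x _ _ hC₀, hD x _ _ hD₀]
  · intro x hA₀ hC₀ hD₀
    refine hnode x _ _ _ (by rintro ⟨⟩ ⟨⟩) fun p hp => ?_
    obtain rfl | rfl | rfl : p = sA ∨ p = sC ∨ p = sD := by
      simpa [edges] using hp
    exacts [hA x _ _ hA₀, hC x _ _ hC₀, hD x _ _ hD₀]
  · intro x hA₀ hB₀ hC₀
    refine hnode x _ _ _ (by rintro ⟨⟩ ⟨⟩) fun p hp => ?_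
    obtain rfl | rfl | rfl : p = sA ∨ p = sB ∨ p = sC := by
      simpa [edges] using hp
    exacts [hA x _ _ hA₀, hB x _ _ hB₀, hC x _ _ hC₀]
  · intro x hW₀ hX₀ hZ₀
    refine hnode x _ _ _ (by rintro ⟨⟩ ⟨⟩) fun p hp => ?_
    obtain rfl | rfl | rfl : p = n4 ∨ p = n6 ∨ p = n2 := by
      simpa [edges] using hp
    exacts [hWout x _ _ hW₀, hXout x _ _ hX₀, hZout x _ _ hZ₀]
  · intro x hB₀ hD₀ hY₀
    refine hdem x n9 .A rfl (by rintro ⟨⟩ ⟨⟩) fun p hp => ?_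
    obtain rfl | rfl | rfl : p = sB ∨ p = sD ∨ p = n8 := by
      simpa [edges] using hp
    exacts [hB x _ _ hB₀, hD x _ _ hD₀, hYout x _ _ hY₀]
  · intro x hA₀ hW₀ hZ₀
    refine hdem x n10 .D rfl (by rintro ⟨⟩ ⟨⟩) fun p hp => ?_
    obtain rfl | rfl | rfl : p = sA ∨ p = n4 ∨ p = n2 := by
      simpa [edges] using hp
    exacts [hA x _ _ hA₀, hWout x _ _ hW₀, hZout x _ _ hZ₀]
  · intro x hD₀ hY₀ hZ₀
    refine hdem x n11 .C rfl (by rintro ⟨⟩ ⟨⟩) fun p hp => ?_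
    obtain rfl | rfl | rfl : p = sD ∨ p = n8 ∨ p = n2 := by
      simpa [edges] using hp
    exacts [hD x _ _ hD₀, hYout x _ _ hY₀, hZout x _ _ hZ₀]
  · intro x hD₀ hX₀ hZ₀
    refine hdem x n12 .B rfl (by rintro ⟨⟩ ⟨⟩) fun p hp => ?_
    obtain rfl | rfl | rfl : p = sD ∨ p = n6 ∨ p = n2 := by
      simpa [edges] using hp
    exacts [hD x _ _ hD₀, hXout x _ _ hX₀, hZout x _ _ hZ₀]
  · intro x hA₀ hW₀ hY₀
    refine hdem x n14 .C rfl (by rintro ⟨⟩ ⟨⟩) fun p hp => ?_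
    obtain rfl | rfl | rfl : p = sA ∨ p = n4 ∨ p = n8 := by
      simpa [edges] using hp
    exacts [hA x _ _ hA₀, hWout x _ _ hW₀, hYout x _ _ hY₀]
  · intro x hA₀ hW₀ hX₀
    refine hdem x n15 .B rfl (by rintro ⟨⟩ ⟨⟩) fun p hp => ?_
    obtain rfl | rfl | rfl : p = sA ∨ p = n4 ∨ p = n6 := by
      simpa [edges] using hp
    exacts [hA x _ _ hA₀, hWout x _ _ hW₀, hXout x _ _ hX₀]

theorem twelve_mul_le_of_isLinear (h3 : (3 : F) ≠ 0) {c : network.Code F k n} (hl : c.IsLinear)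
    (hc : c.IsSolution) : 12 * k ≤ 11 * n := by
  obtain ⟨W, X, Y, Z, hWa, hXb, hZd, hY, h9, h10, h11, h12, h14, h15⟩ :=
    exists_bottleneck_maps hl hc
  let ι : Msg → (Fin k → F) →ₗ[F] (Msg → Fin k → F) := LinearMap.single F fun _ => Fin k → F
  have hsplit : ∀ a b c d : Fin k → F, msgs a b c d = ι .A a + ι .B b + ι .C c + ι .D d := by
    intro a b c d
    funext m
    cases m <;> simp [ι, msgs]
  have key : ∀ (T : (Msg → Fin k → F) →ₗ[F] (Fin n → F)) (a b c d : Fin k → F),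
      T (msgs a b c d) = T (ι .A a) + T (ι .B b) + T (ι .C c) + T (ι .D d) := fun T a b c d => by
    rw [hsplit, map_add, map_add, map_add]
  have kW : ∀ a b c d, W (msgs a b c d) = W (ι .B b) + W (ι .C c) + W (ι .D d) := fun a b c d => by
    rw [key, hWa (ι .A a) (by simp [ι]) (by simp [ι]) (by simp [ι]), zero_add]
  have kX : ∀ a b c d, X (msgs a b c d) = X (ι .A a) + X (ι .C c) + X (ι .D d) := fun a b c d => by
    rw [key, hXb (ι .B b) (by simp [ι]) (by simp [ι]) (by simp [ι]), add_zero]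
  have kZ : ∀ a b c d, Z (msgs a b c d) = Z (ι .A a) + Z (ι .B b) + Z (ι .C c) := fun a b c d => by
    rw [key, hZd (ι .D d) (by simp [ι]) (by simp [ι]) (by simp [ι]), add_zero]
  have kY := key Y
  have := twelve_mul_finrank_le h3 (Z ∘ₗ ι .A) (Z ∘ₗ ι .B) (Z ∘ₗ ι .C) (W ∘ₗ ι .B) (W ∘ₗ ι .C)
    (W ∘ₗ ι .D) (X ∘ₗ ι .A) (X ∘ₗ ι .C) (X ∘ₗ ι .D) (Y ∘ₗ ι .A) (Y ∘ₗ ι .B) (Y ∘ₗ ι .C)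
    (Y ∘ₗ ι .D)
    (fun a b c d e₁ e₂ e₃ => (kY a b c d).symm.trans
      (hY _ ((kW a b c d).trans e₁) ((kX a b c d).trans e₂) ((kZ a b c d).trans e₃)))
    (fun a c e => h9 (msgs a 0 c 0) rfl rfl (by rw [kY]; simpa using e))
    (fun b c d e e' => h10 (msgs 0 b c d) rfl (by rw [kW]; simpa using e)
      (by rw [kZ]; simpa using e'))
    (fun a b c e e' => h11 (msgs a b c 0) rfl (by rw [kY]; simpa using e)
      (by rw [kZ]; simpa using e'))
    (fun a b c e e' => h12 (msgs a b c 0) rfl (by rw [kX]; simpa using e)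
      (by rw [kZ]; simpa using e'))
    (fun b c d e e' => h14 (msgs 0 b c d) rfl (by rw [kW]; simpa using e)
      (by rw [kY]; simpa using e'))
    (fun b c d e e' => h15 (msgs 0 b c d) rfl (by rw [kW]; simpa using e)
      (by rw [kX]; simpa using e'))
  simpa using this

end Linear

/-! ### Computation of the capacities -/

section Capacity

theorem natCast_div_le_one {k n : ℕ} (h : k ≤ n) : (k : ℝ≥0∞) / n ≤ 1 :=
  ENNReal.div_le_of_le_mul (by rw [one_mul]; exact_mod_cast h)

theorem one_le_of_forall_div_le {s : ℝ≥0∞}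
    (h : ∀ k : ℕ, 0 < k → (k : ℝ≥0∞) / (k + 2 : ℕ) ≤ s) : 1 ≤ s := by
  by_contra! hs
  lift s to NNReal using hs.ne_top
  have hs' : (s : ℝ) < 1 := by exact_mod_cast hs
  -- k ≤ s(k+2) would give k(1-s) ≤ 2s < 2.
  obtain ⟨k, hk⟩ := exists_nat_gt (2 / (1 - (s : ℝ)))
  have hk₀ : 0 < k := by
    have : (0 : ℝ) < k := (div_pos two_pos (sub_pos.2 hs')).trans hk
    exact_mod_cast this
  have h₁ := (ENNReal.div_le_iff (by simp) (by simp)).1 (h k hk₀)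
  have h₂ : (k : ℝ) ≤ s * (k + 2 : ℕ) := by exact_mod_cast h₁
  rw [div_lt_iff₀ (sub_pos.2 hs')] at hk
  push_cast at h₂
  nlinarith

/-- Two spare symbols suffice because q² ≥ 4 > 3: the least power of 3 that is at least q^k is below
3q^k, unless q^k = 1. Injections then carry messages into the group and group elements onto edges.
-/
theorem exists_isSolution (𝒜 : Type*) [Finite 𝒜] [Nontrivial 𝒜] (k : ℕ) :
    ∃ c : network.Code 𝒜 k (k + 2), c.IsSolution := by
  set q := Nat.card 𝒜
  have hq : 2 ≤ q := Finite.one_lt_card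
  -- a power of `3` in the interval `[q ^ k, q ^ (k + 2)]`
  obtain ⟨m, hm, hm'⟩ : ∃ m, q ^ k ≤ 3 ^ m ∧ 3 ^ m ≤ q ^ (k + 2) := by
    refine ⟨Nat.clog 3 (q ^ k), Nat.le_pow_clog (by norm_num) _, ?_⟩
    have hpos : 1 ≤ q ^ k := Nat.one_le_pow _ _ (by omega)
    have h4 : 4 * q ^ k ≤ q ^ (k + 2) := by
      rw [pow_add, mul_comm]
      exact Nat.mul_le_mul_left _ (by nlinarith)
    rcases hpos.eq_or_lt with h1 | h1
    · rw [← h1]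
      simpa using Nat.one_le_pow _ _ (by omega)
    · have h₁ := Nat.pow_pred_clog_lt_self (b := 3) (by norm_num) h1
      have h₂ : 0 < Nat.clog 3 (q ^ k) := Nat.clog_pos (by norm_num) h1
      have h₃ : 3 ^ Nat.clog 3 (q ^ k) = 3 ^ (Nat.clog 3 (q ^ k)).pred * 3 := by
        rw [← pow_succ, ← Nat.succ_eq_add_one, Nat.succ_pred_eq_of_pos h₂]
      omega
  let G := Fin m → ZMod 3
  have hG : Nat.card G = 3 ^ m := by simp [G]
  have hcard : ∀ j, Nat.card (Fin j → 𝒜) = q ^ j := fun j => by rw [Nat.card_fun, Nat.card_fin]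
  obtain ⟨enc⟩ : Nonempty ((Fin k → 𝒜) ↪ G) := by
    have := Fintype.ofFinite (Fin k → 𝒜)
    exact Function.Embedding.nonempty_of_card_le (by
      rw [← Nat.card_eq_fintype_card, ← Nat.card_eq_fintype_card, hG, hcard]; exact hm)
  obtain ⟨put⟩ : Nonempty (G ↪ (Fin (k + 2) → 𝒜)) := by
    have := Fintype.ofFinite (Fin (k + 2) → 𝒜)
    exact Function.Embedding.nonempty_of_card_le (by
      rw [← Nat.card_eq_fintype_card, ← Nat.card_eq_fintype_card, hG, hcard]; exact hm')
  refine ⟨_, sumCode_isSolution (G := G) ?_ (Function.leftInverse_invFun enc.injective)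
    (Function.leftInverse_invFun put.injective)⟩
  intro g
  funext i
  change g i + g i + g i = 0
  generalize g i = t
  revert t
  decide

theorem codingCapacityOver_eq_one (𝒜 : Type*) [Finite 𝒜] [Nontrivial 𝒜] :
    network.codingCapacityOver 𝒜 = 1 := by
  refine le_antisymm (sSup_le ?_) (one_le_of_forall_div_le fun k hk => le_sSup ?_)
  · rintro _ ⟨k, n, -, -, ⟨c, hc⟩, rfl⟩
    exact natCast_div_le_one (le_of_isSolution hc)
  · exact ⟨k, k + 2, hk, by omega, exists_isSolution 𝒜 k, rfl⟩

theorem codingCapacity_eq_one : network.codingCapacity = 1 := by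
  refine le_antisymm (sSup_le ?_) ?_
  · rintro _ ⟨𝒜, _, _, k, n, -, -, ⟨c, hc⟩, rfl⟩
    exact natCast_div_le_one (le_of_isSolution hc)
  · rw [← codingCapacityOver_eq_one Bool]
    refine sSup_le_sSup ?_
    rintro _ ⟨k, n, h⟩
    exact ⟨Bool, inferInstance, inferInstance, k, n, h⟩

theorem linearCapacityOver_eq_one (F : Type*) [Field F] [Finite F] [CharP F 3] :
    network.linearCapacityOver F = 1 := by
  refine le_antisymm (sSup_le ?_) (le_sSup ?_)
  · rintro _ ⟨k, n, -, -, ⟨c, -, hc⟩, rfl⟩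
    exact natCast_div_le_one (le_of_isSolution hc)
  · have h3 : ∀ g : Fin 1 → F, g + g + g = 0 := fun g => by
      have h : (3 : F) = 0 := by exact_mod_cast CharP.cast_eq_zero F 3
      funext i
      change g i + g i + g i = 0
      linear_combination g i * h
    have hid : IsLinearMap F (id : (Fin 1 → F) → Fin 1 → F) := LinearMap.id.isLinear
    -- In characteristic 3 the field itself is the group, so rate 1 is attained with k = n = 1.
    exact ⟨1, 1, one_pos, one_pos, ⟨sumCode id id id id, sumCode_isLinear hid hid hid hid,
      sumCode_isSolution h3 (fun _ => rfl) (fun _ => rfl)⟩, by simp⟩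

theorem linearCapacityOver_le (F : Type*) [Field F] (h : ¬ CharP F 3) :
    network.linearCapacityOver F ≤ 11 / 12 := by
  have h3 : (3 : F) ≠ 0 := fun h0 =>
    h ((CharP.charP_iff_prime_eq_zero Nat.prime_three).2 (by exact_mod_cast h0))
  refine sSup_le ?_
  rintro _ ⟨k, n, -, hn, ⟨c, hl, hc⟩, rfl⟩
  have hk : (12 : ℝ≥0∞) * k ≤ 11 * n := by exact_mod_cast twelve_mul_le_of_isLinear h3 hl hc
  rw [ENNReal.div_le_iff (by exact_mod_cast hn.ne') (by simp), ← ENNReal.mul_div_right_comm,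
    ENNReal.le_div_iff_mul_le (by simp) (by simp), mul_comm]
  exact hk

end Capacity

end T8

theorem mainTheorem3 :
    (∀ (F : Type*) [Field F] [Finite F], ¬ CharP F 3 →
      T8.network.linearCapacityOver F ≤ 48 / 49) ∧
    (∀ (F : Type*) [Field F] [Finite F], CharP F 3 →
      T8.network.linearCapacityOver F = 1) ∧
    (∀ (𝒜 : Type*) [Finite 𝒜] [Nontrivial 𝒜], T8.network.codingCapacityOver 𝒜 = 1) ∧
    T8.network.codingCapacity = 1 := by
  refine ⟨fun F _ _ h => (T8.linearCapacityOver_le F h).trans ?_,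
    fun F _ _ _ => T8.linearCapacityOver_eq_one F,
    fun 𝒜 _ _ => T8.codingCapacityOver_eq_one 𝒜, T8.codingCapacity_eq_one⟩
  -- 11/12 ≤ 48/49, since 11·49 = 539 ≤ 576 = 48·12.
  rw [ENNReal.div_le_iff (by simp) (by simp), ← ENNReal.mul_div_right_comm,
    ENNReal.le_div_iff_mul_le (by simp) (by simp)]
  norm_num
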